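/- **Setting.** A *vertex operator superalgebra* is a complex vector space $V=\bigoplus_{n\in\frac12\mathbb Z_{\ge 0}}V_n$ with $\dim V_n<\infty$, together with vectors $\mathbf 1\in V_0$, $\omega\in V_2$ and a linear map $v\mapsto Y(v,z)=\sum_{n\in\mathbb Z}v_nz^{-n-1}\in(\mathrm{End}\,V)[[z,z^{-1}]]$. Put $V_{\bar 0}=\bigoplus_{n\in\mathbb Z}V_n$, $V_{\bar 1}=\bigoplus_{n\in\frac12+\mathbb Z}V_n$, and $\tilde v=i$ for $v\in V_{\bar i}$. Write $\mathrm{wt}\,u=n$ for $u\in V_n$ and $L(m)=\omega_{m+1}$. It is required that, for all $u,v\in V$ and $m,n\in\mathbb Z$: * $u_nv=0$ for $n$ sufficiently large; $Y(\mathbf 1,z)=\mathrm{Id}_V$; $Y(v,z)\mathbf 1\in V[[z]]$ with constant term $v$; * $[L(m),L(n)]=(m-n)L(m+n)+\frac1{12}(m^3-m)\delta_{m+n,0}\,c$ for some constant $c\in\mathbb C$; $\frac{d}{dz}Y(v,z)=Y(L(-1)v,z)$; $L(0)|_{V_n}=n$; * for $u,v$ each even or odd, the Jacobi identity $$z_0^{-1}\delta\!\left(\tfrac{z_1-z_2}{z_0}\right)Y(u,z_1)Y(v,z_2)-(-1)^{\tilde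 u\tilde v}z_0^{-1}\delta\!\left(\tfrac{z_2-z_1}{-z_0}\right)Y(v,z_2)Y(u,z_1)=z_2^{-1}\delta\!\left(\tfrac{z_1-z_0}{z_2}\right)Y(Y(u,z_0)v,z_2)$$ holds, where $\delta(z)=\sum_{n\in\mathbb Z}z^n$ and $(z_i-z_j)^n$ is expanded in nonnegative powers of $z_j$. An *automorphism* of $V$ is a linear automorphism $g$ with $g\omega=\omega$ and $gY(v,z)g^{-1}=Y(gv,z)$ for all $v\in V$. Let $\sigma$ be the automorphism equal to $1$ on $V_{\bar 0}$ and to $-1$ on $V_{\bar 1}$. Let $g$ be an automorphism of $V$ of finite order, let $T$ be the order of $g\sigma$, and for $0\le r<T$ let $V^{r*}=\{v\in V: g\sigma v=e^{2\pi i r/T}v\}$, so that $V=\bigoplus_{r=0}^{T-1}V^{r*}$. Let $\delta_r=1$ if $r=0$ and $\delta_r=0$ otherwise. For homogeneous $u\in V^{r*}$ (that is, $u\in V_n\cap V^{r*}$ for some $n$) and $v\in V$ put $$u\circ_g v=\mathrm{Res}_z\,\frac{(1+z)^{\mathrm{wt}\,u-1+\delta_r+\frac rT}}{z^{1+\delta_r}}\,Y(u,z)v,\qquad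 u*_gv=\begin{cases}\mathrm{Res}_z\,\dfrac{(1+z)^{\mathrm{wt}\,u}}{z}\,Y(u,z)v & \text{if } r=0,\\[1ex] 0 & \text{if } r>0,\end{cases}$$ where powers of $1+z$ are expanded in nonnegative powers of $z$, and extend $*_g$ to a bilinear product on $V$. Let $O_g(V)$ be the linear span of all $u\circ_gv$ and let $A_g(V)=V/O_g(V)$. **Theorem.** 1. The product $*_g$ induces a well-defined bilinear product on $A_g(V)$, which makes $A_g(V)$ an associative algebra over $\mathbb C$. 2. $\mathbf 1+O_g(V)$ is a two-sided unit of $A_g(V)$. 3. $\omega+O_g(V)$ lies in the center of $A_g(V)$. -/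

import Mathlib

open scoped DirectSum

noncomputable section

namespace VertexOperatorSuperalgebra

/-- The mode `u_n` of `Y(u, z) = ∑ n, u_n z^(-n-1)`, applied to `v`. -/
def modeOf {V : Type*} [AddCommGroup V] [Module ℂ V] (Y : V →ₗ[ℂ] VertexOperator ℂ V)
    (u : V) (n : ℤ) (v : V) : V :=
  VertexOperator.ncoeff (Y u) n v

end VertexOperatorSuperalgebra

open VertexOperatorSuperalgebra in
/-- A vertex operator superalgebra structure on a complex vector space `V`.

The `½ℤ₊`-grading is indexed by `ℕ`: `grade n` is the homogeneous space of weight `n / 2`.  The even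
part is the sum of the `grade n` with `n` even (integral weight), the odd part is the sum of the
`grade n` with `n` odd, so that the sign `(-1)^{ũ ṽ}` for `u ∈ grade p`, `v ∈ grade q` is
`(-1)^(p * q)`.

The state-field map `Y` takes values in Mathlib's vertex operators (linear maps from `V` to the
Laurent series with coefficients in `V`), which includes the condition `u_n v = 0` for `n`
sufficiently large. -/
structure VertexOperatorSuperalgebra (V : Type*) [AddCommGroup V] [Module ℂ V] where
  /-- `grade n` is the homogeneous space of weight `n / 2`. -/
  grade : ℕ → Submodule ℂ V
  isInternal : DirectSum.IsInternal grade
  finiteDimensional : ∀ n, FiniteDimensional ℂ (grade n)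
  /-- The state-field correspondence. -/
  Y : V →ₗ[ℂ] VertexOperator ℂ V
  /-- The vacuum vector `𝟏`, of weight `0`. -/
  vacuum : V
  vacuum_mem : vacuum ∈ grade 0
  /-- The conformal vector `ω`, of weight `2`. -/
  conformal : V
  conformal_mem : conformal ∈ grade 4
  /-- The central charge `c`. -/
  centralCharge : ℂ
  /-- `Y(𝟏, z) = Id`. -/
  vacuum_mode : ∀ (n : ℤ) (v : V), modeOf Y vacuum n v = if n = -1 then v else 0
  /-- `Y(v, z) 𝟏` is a power series in `z`. -/
  mode_vacuum_of_nonneg : ∀ (v : V) (n : ℤ), 0 ≤ n → modeOf Y v n vacuum = 0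
  /-- The constant term of `Y(v, z) 𝟏` is `v`. -/
  mode_neg_one_vacuum : ∀ v : V, modeOf Y v (-1) vacuum = v
  /-- The Virasoro relations for `L(m) = ω_{m+1}`. -/
  virasoro : ∀ (m n : ℤ) (v : V),
    modeOf Y conformal (m + 1) (modeOf Y conformal (n + 1) v)
        - modeOf Y conformal (n + 1) (modeOf Y conformal (m + 1) v)
      = ((m : ℂ) - n) • modeOf Y conformal (m + n + 1) v
        + (if m + n = 0 then ((m : ℂ) ^ 3 - m) / 12 * centralCharge else 0) • v
  /-- `d/dz Y(v, z) = Y(L(-1) v, z)`, read off at the coefficient of `z^(-n-1)`. -/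
  derivative : ∀ (v : V) (n : ℤ) (w : V),
    modeOf Y (modeOf Y conformal 0 v) n w = (-(n : ℂ)) • modeOf Y v (n - 1) w
  /-- `L(0)` acts on the homogeneous space of weight `n / 2` as `n / 2`. -/
  L_zero : ∀ (n : ℕ), ∀ v ∈ grade n, modeOf Y conformal 1 v = ((n : ℂ) / 2) • v
  /-- The Jacobi identity: equality of the coefficients of `z₀^(-l-1) z₁^(-m-1) z₂^(-n-1)` in
  `z₀⁻¹ δ((z₁ - z₂) / z₀) Y(u, z₁) Y(v, z₂) - (-1)^{ũ ṽ} z₀⁻¹ δ((z₂ - z₁) / (-z₀)) Y(v, z₂) Y(u, z₁)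
    = z₂⁻¹ δ((z₁ - z₀) / z₂) Y(Y(u, z₀) v, z₂)`
  applied to `w`, where `(zᵢ - zⱼ)^k` is expanded in nonnegative powers of `zⱼ`.  All sums have
  finite support. -/
  jacobi : ∀ (p q : ℕ), ∀ u ∈ grade p, ∀ v ∈ grade q, ∀ (w : V) (l m n : ℤ),
    (∑ᶠ i : ℕ, ((-1 : ℂ) ^ i * (Ring.choose l i : ℤ)) •
        modeOf Y u (m + l - i) (modeOf Y v (n + i) w))
      - (-1 : ℂ) ^ (p * q) • (∑ᶠ i : ℕ, ((-1 : ℂ) ^ l * (-1 : ℂ) ^ i * (Ring.choose l i : ℤ)) •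
        modeOf Y v (n + l - i) (modeOf Y u (m + i) w))
      = ∑ᶠ i : ℕ, ((Ring.choose m i : ℤ) : ℂ) • modeOf Y (modeOf Y u (l + i) v) (m + n - i) w

namespace VertexOperatorSuperalgebra

variable {V : Type*} [AddCommGroup V] [Module ℂ V] (S : VertexOperatorSuperalgebra V)

/-- The mode `u_n` applied to `v`. -/
def mode (u : V) (n : ℤ) (v : V) : V := modeOf S.Y u n v

theorem mode_eq_zero_of_large (u v : V) :
    ∃ N : ℤ, ∀ n : ℤ, N < n → S.mode u n v = 0 := by
  refine ⟨- HahnSeries.order ((HahnModule.of ℂ).symm (S.Y u v)) - 1, fun n hn => ?_⟩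
  exact VertexOperator.ncoeff_eq_zero_of_lt_order _ _ _ (by omega)

theorem finite_support_mode (f : ℕ → ℂ) (k : ℤ) (u v : V) :
    (Function.support fun i : ℕ => f i • S.mode u ((i : ℤ) - k) v).Finite := by
  obtain ⟨N, hN⟩ := S.mode_eq_zero_of_large u v
  refine (Set.finite_Iic (N + k).toNat).subset fun i hi => ?_
  by_contra h
  refine hi ?_
  simp only [Set.mem_Iic, not_le] at h
  simp [hN ((i : ℤ) - k) (by omega)]

/-- The residue `Res_z (1 + z)^α z^(-k) Y(u, z) v = ∑ i, (α choose i) u_{i-k} v`, where `(1 + z)^α`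
is expanded in nonnegative powers of `z`, as a bilinear map of `u` and `v`. -/
def residue (α : ℂ) (k : ℤ) : V →ₗ[ℂ] V →ₗ[ℂ] V :=
  LinearMap.mk₂ ℂ (fun u v => ∑ᶠ i : ℕ, Ring.choose α i • S.mode u ((i : ℤ) - k) v)
    (fun u u' v => by
      rw [← finsum_add_distrib (S.finite_support_mode _ _ _ _) (S.finite_support_mode _ _ _ _)]
      simp [mode, modeOf, smul_add])
    (fun c u v => by
      rw [smul_finsum' c (S.finite_support_mode _ _ _ _)]
      simp [mode, modeOf, smul_comm c])
    (fun u v v' => by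
      rw [← finsum_add_distrib (S.finite_support_mode _ _ _ _) (S.finite_support_mode _ _ _ _)]
      simp [mode, modeOf, smul_add])
    (fun c u v => by
      rw [smul_finsum' c (S.finite_support_mode _ _ _ _)]
      simp [mode, modeOf, smul_comm c])

/-- The decomposition of `V` as the direct sum of its homogeneous spaces. -/
def decomposition : (⨁ n, S.grade n) ≃ₗ[ℂ] V :=
  LinearEquiv.ofBijective (DirectSum.coeLinearMap S.grade) S.isInternal

theorem decomposition_symm_of_mem {n : ℕ} {v : V} (hv : v ∈ S.grade n) :
    S.decomposition.symm v = DirectSum.lof ℂ ℕ (fun n => S.grade n) n ⟨v, hv⟩ := by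
  rw [LinearEquiv.symm_apply_eq]
  exact (DirectSum.coeLinearMap_lof S.grade n ⟨v, hv⟩).symm

/-- The canonical automorphism `σ`: the identity on the even part and `-1` on the odd part. -/
def parity : V ≃ₗ[ℂ] V :=
  (S.decomposition.symm.trans (DFinsupp.mapRange.linearEquiv fun n =>
    if Even n then LinearEquiv.refl ℂ (S.grade n) else LinearEquiv.neg ℂ)).trans S.decomposition

theorem parity_of_mem {n : ℕ} {v : V} (hv : v ∈ S.grade n) :
    S.parity v = (-1 : ℂ) ^ n • v := by
  have h : S.parity v = S.decomposition (DirectSum.lof ℂ ℕ (fun n => S.grade n) n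
      ((if Even n then LinearEquiv.refl ℂ (S.grade n) else LinearEquiv.neg ℂ) ⟨v, hv⟩)) := by
    simp only [parity, LinearEquiv.trans_apply, S.decomposition_symm_of_mem hv]
    congr 1
    exact DFinsupp.mapRange_single (hf := fun i => map_zero _)
  rw [h]
  refine (DirectSum.coeLinearMap_lof S.grade n _).trans ?_
  by_cases hn : Even n
  · simp [hn, hn.neg_one_pow]
  · simp [hn, (Nat.not_even_iff_odd.mp hn).neg_one_pow]

/-- An automorphism of a vertex operator superalgebra: a linear automorphism `g` with `g ω = ω` and
`g Y(v, z) g⁻¹ = Y(g v, z)`. -/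
structure IsAutomorphism (g : V ≃ₗ[ℂ] V) : Prop where
  map_conformal : g S.conformal = S.conformal
  conj_mode : ∀ (v : V) (n : ℤ) (w : V), g (S.mode v n (g.symm w)) = S.mode (g v) n w

variable (g : V ≃ₗ[ℂ] V)

/-- The order `T` of `g σ`. -/
def twistOrder : ℕ := orderOf (g * S.parity)

/-- The eigenspace `V^{r*} = {v | g σ v = exp (2 π i r / T) v}`. -/
def eigen (r : ℕ) : Submodule ℂ V :=
  Module.End.eigenspace ((g * S.parity : V ≃ₗ[ℂ] V) : Module.End ℂ V)
    (Complex.exp (2 * Real.pi * Complex.I * r / S.twistOrder g))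

/-- The subspace `O_g(V)`: the span of all
`u ∘_g v = Res_z (1 + z)^(wt u - 1 + δ_r + r / T) z^(-1-δ_r) Y(u, z) v`
for homogeneous `u ∈ V^{r*}` with `0 ≤ r < T` and for `v ∈ V`. -/
def Og : Submodule ℂ V :=
  Submodule.span ℂ {x | ∃ (n r : ℕ) (u v : V), r < S.twistOrder g ∧ u ∈ S.grade n ∧
    u ∈ S.eigen g r ∧
    x = S.residue ((n : ℂ) / 2 - 1 + (if r = 0 then 1 else 0) + (r : ℂ) / S.twistOrder g)
      (1 + (if r = 0 then 1 else 0)) u v}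

/-- The linear space `A_g(V) = V / O_g(V)`. -/
abbrev Ag : Type _ := V ⧸ S.Og g

/-- The projection of `V` onto `V^{0*}` along the other eigenspaces of `g σ` (for `g σ` of finite
order), as an average over the powers of `g σ`. -/
def eigenProj : V →ₗ[ℂ] V :=
  (S.twistOrder g : ℂ)⁻¹ • ∑ k ∈ Finset.range (S.twistOrder g),
    (((g * S.parity) ^ k : V ≃ₗ[ℂ] V) : V →ₗ[ℂ] V)

/-- The bilinear product `*_g` on `V`: it is `Res_z (1 + z)^(wt u) z⁻¹ Y(u, z) v` for homogeneous
`u ∈ V^{0*}`, it is `0` for `u ∈ V^{r*}` with `0 < r < T`, and it is extended linearly. -/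
def star : V →ₗ[ℂ] V →ₗ[ℂ] V :=
  (DirectSum.toModule ℂ ℕ (V →ₗ[ℂ] V)
      (fun n => (S.residue ((n : ℂ) / 2) 1).comp (S.grade n).subtype)
    ∘ₗ S.decomposition.symm.toLinearMap) ∘ₗ S.eigenProj g

theorem pow_apply_of_mem_eigen {r : ℕ} {u : V} (hu : u ∈ S.eigen g r) (k : ℕ) :
    ((g * S.parity) ^ k) u
      = Complex.exp (2 * Real.pi * Complex.I * r / S.twistOrder g) ^ k • u := by
  have h : (g * S.parity) u
      = Complex.exp (2 * Real.pi * Complex.I * r / S.twistOrder g) • u :=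
    Module.End.mem_eigenspace_iff.mp hu
  induction k with
  | zero => simp
  | succ k ih => rw [pow_succ', LinearEquiv.mul_apply, ih, map_smul, h, smul_smul, pow_succ]

/-- On homogeneous `u ∈ V^{0*}` the product is the residue of the definition. -/
theorem star_of_mem_zero (hT : 0 < S.twistOrder g) {n : ℕ} {u : V} (hn : u ∈ S.grade n)
    (hu : u ∈ S.eigen g 0) (v : V) : S.star g u v = S.residue ((n : ℂ) / 2) 1 u v := by
  have hT' : (S.twistOrder g : ℂ) ≠ 0 := by exact_mod_cast hT.ne'
  have h : S.eigenProj g u = u := by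
    have hk : ∀ k, ((g * S.parity) ^ k) u = u := fun k => by
      rw [S.pow_apply_of_mem_eigen g hu k]; simp
    simp [eigenProj, hk, ← Nat.cast_smul_eq_nsmul ℂ, smul_smul, hT']
  simp only [star, LinearMap.comp_apply, h, LinearEquiv.coe_coe, S.decomposition_symm_of_mem hn,
    DirectSum.toModule_lof, Submodule.subtype_apply]

/-- On `V^{r*}` with `0 < r < T` the product is zero. -/
theorem star_of_mem_pos {r : ℕ} (hr : 0 < r) (hrT : r < S.twistOrder g) {u : V}
    (hu : u ∈ S.eigen g r) (v : V) : S.star g u v = 0 := by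
  have hT : S.twistOrder g ≠ 0 := by omega
  have hprim := Complex.isPrimitiveRoot_exp (S.twistOrder g) hT
  have hexp : Complex.exp (2 * Real.pi * Complex.I * r / S.twistOrder g)
      = Complex.exp (2 * Real.pi * Complex.I / S.twistOrder g) ^ r := by
    rw [← Complex.exp_nat_mul]; congr 1; ring
  have hne : Complex.exp (2 * Real.pi * Complex.I * r / S.twistOrder g) ≠ 1 := by
    rw [hexp]; exact hprim.pow_ne_one_of_pos_of_lt hr.ne' hrT
  have hpow : Complex.exp (2 * Real.pi * Complex.I * r / S.twistOrder g) ^ S.twistOrder g = 1 := by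
    rw [hexp, pow_right_comm, hprim.pow_eq_one, one_pow]
  have h : S.eigenProj g u = 0 := by
    have hs : ∑ k ∈ Finset.range (S.twistOrder g), ((g * S.parity) ^ k) u = 0 := by
      simp only [S.pow_apply_of_mem_eigen g hu, ← Finset.sum_smul]
      rw [geom_sum_eq hne, hpow]; simp
    simp [eigenProj, hs]
  simp [star, h]

end VertexOperatorSuperalgebra

end

open scoped DirectSum

noncomputable section

open Finset Filter

/-! The argument is Zhu's residue calculus. Pairing the Jacobi identity with (1 + z₁)^α (1 + z₂)^β
z₁^(-m) z₂^(-n) (z₁ - z₂)^l gives a relation between iterated residues, `eventually_jacobi_residue`.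
Its case l = 0 is a commutator formula, its case m = 0 a formula for residues of iterates.

The other ingredient is a supply of elements of O_g(V). By the L(-1)-derivative property, for
homogeneous u ∈ V^{r*} the exponent of 1 + z and the pole order in u ∘_g v may be raised by n and m,
provided n ≤ m (`residue_mem_Og_of_le`). Moreover u ∘_g 𝟏 = u for r > 0, so such u vanish in A_g(V)
and the essential case is r = 0.

The rest is bookkeeping of exponents and poles. The commutator formula shows that c *_g (u ∘_g v)
lies in O_g(V), and the iterate formula does so for (u ∘_g v) *_g c. In the iterate formula for (a
*_g b) *_g c the leading term is a *_g (b *_g c), and all others have poles high enough to lie in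
O_g(V). Finally ω *_g b - b *_g ω ≡ L(-1)b + L(0)b = b ∘_g 𝟏 for b ∈ V^{0*}.

All sums have finite support. They are cut off at some N, and `∀ᶠ N in atTop` lets several cutoffs
be taken equal. -/

/-! ### Binomial identities -/

/-- Absorb the natural binomial by (α choose x)(x choose j) = (α choose j)(α - j choose x - j), then
apply Vandermonde. -/
theorem sum_antidiagonal_choose_mul_natChoose (α β : ℂ) (j q : ℕ) :
    ∑ x ∈ antidiagonal q, Ring.choose α x.1 * Ring.choose β x.2 * (Nat.choose x.1 j : ℂ)
      = if j ≤ q then Ring.choose α j * Ring.choose (α + β - j) (q - j) else 0 := by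
  rw [Finset.Nat.sum_antidiagonal_eq_sum_range_succ_mk]
  split_ifs with h
  · obtain ⟨t, rfl⟩ := Nat.exists_eq_add_of_le h
    rw [Nat.succ_eq_add_one, add_assoc, sum_range_add, sum_eq_zero, zero_add, add_tsub_cancel_left,
      show α + β - j = (α - j) + β by ring, Ring.add_choose_eq _ (Commute.all _ _), mul_sum,
      Finset.Nat.sum_antidiagonal_eq_sum_range_succ_mk]
    · refine sum_congr rfl fun i hi => ?_
      have := Ring.choose_smul_choose α (Nat.le_add_right j i)
      rw [nsmul_eq_mul, add_tsub_cancel_left] at this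
      rw [Nat.add_sub_add_left]
      linear_combination Ring.choose β (t - i) * this
    · intro i hi
      simp [Nat.choose_eq_zero_of_lt (mem_range.1 hi)]
  · refine sum_eq_zero fun i hi => ?_
    have := mem_range.1 hi
    simp [Nat.choose_eq_zero_of_lt (show i < j by omega)]

/-- The coefficient identity behind the substitution `z₁ = z₂ + z₀` in
`(1 + z₁)^α (1 + z₂)^β z₁^m`. -/
theorem sum_antidiagonal_choose_mul_choose_add (α β m : ℂ) (k q : ℕ) :
    ∑ x ∈ antidiagonal q, Ring.choose α x.1 * Ring.choose β x.2 * Ring.choose (m + x.1) k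
      = ∑ y ∈ antidiagonal k, Ring.choose m y.1 * Ring.choose α y.2 *
          (if y.2 ≤ q then Ring.choose (α + β - y.2) (q - y.2) else 0) := by
  have h (x : ℕ) : Ring.choose (m + x) k
      = ∑ y ∈ antidiagonal k, Ring.choose m y.1 * (Nat.choose x y.2 : ℂ) := by
    rw [Ring.add_choose_eq _ (Commute.all _ _)]
    simp [Ring.choose_natCast]
  simp_rw [h, mul_sum]
  rw [sum_comm]
  refine sum_congr rfl fun y _ => ?_
  have := sum_antidiagonal_choose_mul_natChoose α β y.2 q
  calc _ = Ring.choose m y.1 * ∑ x ∈ antidiagonal q,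
        Ring.choose α x.1 * Ring.choose β x.2 * (Nat.choose x.1 y.2 : ℂ) := by
        rw [mul_sum]; exact sum_congr rfl fun x _ => by ring
    _ = _ := by rw [this]; split_ifs <;> ring

/-- The part of the square outside the triangle i + j < N contributes nothing. -/
theorem sum_range_sum_range_eq_sum_antidiagonal {M : Type*} [AddCommMonoid M] (N : ℕ)
    (f : ℕ → ℕ → M) (hf : ∀ i j, N ≤ i + j → f i j = 0) :
    ∑ i ∈ range N, ∑ j ∈ range N, f i j
      = ∑ q ∈ range N, ∑ x ∈ antidiagonal q, f x.1 x.2 := by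
  rw [← sum_product', Finset.sum_sigma']
  refine (sum_of_injOn (fun x => x.2) ?_ ?_ ?_ ?_).symm
  · rintro ⟨q, x⟩ h ⟨q', x'⟩ h' he
    simp only [coe_sigma, Set.mem_sigma_iff, SetLike.mem_coe,
      HasAntidiagonal.mem_antidiagonal] at h h' he
    obtain ⟨-, h⟩ := h
    obtain ⟨-, h'⟩ := h'
    subst he; subst h; subst h'; rfl
  · rintro ⟨q, x⟩ h
    simp only [coe_sigma, Set.mem_sigma_iff, SetLike.mem_coe,
      HasAntidiagonal.mem_antidiagonal, mem_range] at h
    simp only [SetLike.mem_coe, mem_product, mem_range]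
    omega
  · rintro x hx hx'
    refine hf _ _ ?_
    by_contra hlt
    exact hx' ⟨⟨x.1 + x.2, x⟩, by simpa using hlt, rfl⟩
  · simp

/-! ### Modes and truncated residues -/

namespace VertexOperatorSuperalgebra

variable {V : Type*} [AddCommGroup V] [Module ℂ V] (S : VertexOperatorSuperalgebra V)

/-- The mode `u_n`, as a bilinear map of `u` and of the vector it acts on. -/
def modeHom (n : ℤ) : V →ₗ[ℂ] V →ₗ[ℂ] V :=
  LinearMap.mk₂ ℂ (fun u v => S.mode u n v) (by simp [mode, modeOf]) (by simp [mode, modeOf])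
    (by simp [mode, modeOf]) (by simp [mode, modeOf])

theorem modeHom_apply (n : ℤ) (u v : V) : S.modeHom n u v = S.mode u n v := rfl

theorem mode_smul_right (u : V) (n : ℤ) (c : ℂ) (v : V) :
    S.mode u n (c • v) = c • S.mode u n v := (S.modeHom n u).map_smul c v

theorem mode_smul_left (u : V) (n : ℤ) (c : ℂ) (v : V) :
    S.mode (c • u) n v = c • S.mode u n v := (S.modeHom n).map_smul₂ c u v

theorem mode_zero_right (u : V) (n : ℤ) : S.mode u n 0 = 0 := (S.modeHom n u).map_zero

theorem mode_zero_left (v : V) (n : ℤ) : S.mode 0 n v = 0 := (S.modeHom n).map_zero₂ v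

theorem mode_sum_right {ι : Type*} (u : V) (n : ℤ) (s : Finset ι) (f : ι → V) :
    S.mode u n (∑ i ∈ s, f i) = ∑ i ∈ s, S.mode u n (f i) := map_sum (S.modeHom n u) f s

theorem residue_eq_sum_range (α : ℂ) (k : ℤ) (u v : V) (N : ℕ)
    (hN : ∀ n : ℤ, N - k ≤ n → S.mode u n v = 0) :
    S.residue α k u v = ∑ i ∈ range N, Ring.choose α i • S.mode u ((i : ℤ) - k) v := by
  refine finsum_eq_sum_of_support_subset _ fun i hi => ?_
  by_contra h
  refine hi ?_
  simp only [coe_range, Set.mem_Iio, not_lt] at h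
  simp [hN ((i : ℤ) - k) (by omega)]

theorem eventually_mode_eq_zero (k : ℤ) (u v : V) :
    ∀ᶠ N : ℕ in atTop, ∀ n : ℤ, N - k ≤ n → S.mode u n v = 0 := by
  obtain ⟨M, hM⟩ := S.mode_eq_zero_of_large u v
  filter_upwards [eventually_ge_atTop (M + k + 1).toNat] with N hN n hn
  exact hM n (by omega)

theorem eventually_residue_eq_sum (α : ℂ) (k : ℤ) (u v : V) :
    ∀ᶠ N : ℕ in atTop,
      S.residue α k u v = ∑ i ∈ range N, Ring.choose α i • S.mode u ((i : ℤ) - k) v :=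
  (S.eventually_mode_eq_zero k u v).mono fun N hN => S.residue_eq_sum_range α k u v N hN

/-- One bound serves for all n ≥ -b, because v_n w is nonzero for only finitely many of these n. -/
theorem eventually_mode_mode_eq_zero (a b : ℤ) (u v w : V) :
    ∀ᶠ N : ℕ in atTop, ∀ m n : ℤ, N - a ≤ m → -b ≤ n → S.mode u m (S.mode v n w) = 0 := by
  obtain ⟨K, hK⟩ := (S.eventually_mode_eq_zero b v w).exists
  have h : ∀ᶠ N : ℕ in atTop, ∀ j ∈ range K, ∀ m : ℤ, N - a ≤ m →
      S.mode u m (S.mode v ((j : ℤ) - b) w) = 0 :=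
    (eventually_all_finset _).2 fun j _ => S.eventually_mode_eq_zero a u _
  filter_upwards [h] with N hN m n hm hn
  by_cases hn' : K - b ≤ n
  · rw [hK n hn', mode_zero_right]
  · have := hN (n + b).toNat (mem_range.2 (by omega)) m hm
    rwa [show ((n + b).toNat : ℤ) - b = n by omega] at this

theorem eventually_residue_residue_eq_sum (α β : ℂ) (a b : ℤ) (u v w : V) :
    ∀ᶠ N : ℕ in atTop, S.residue α a u (S.residue β b v w)
      = ∑ i ∈ range N, ∑ j ∈ range N, (Ring.choose α i * Ring.choose β j) •
          S.mode u ((i : ℤ) - a) (S.mode v ((j : ℤ) - b) w) := by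
  filter_upwards [S.eventually_mode_mode_eq_zero a b u v w, S.eventually_residue_eq_sum β b v w]
    with N hN h
  rw [h, S.residue_eq_sum_range α a u _ N fun n hn => ?_]
  · simp_rw [mode_sum_right, mode_smul_right, smul_sum, smul_smul]
  · rw [mode_sum_right]
    refine sum_eq_zero fun j _ => ?_
    rw [mode_smul_right, hN n _ hn (by omega), smul_zero]

/-- The right side is what the iterate side of the Jacobi identity produces at a fixed power of z₀.
The mode depends on i and j only through i + j, so the coefficients can be summed along
antidiagonals. -/
theorem eventually_sum_residue_eq_sum (α β : ℂ) (m n : ℤ) (x w : V) (k : ℕ) :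
    ∀ᶠ N : ℕ in atTop,
      ∑ y ∈ antidiagonal k, (Ring.choose (-m : ℂ) y.1 * Ring.choose α y.2) •
          S.residue (α + β - y.2) (m + n + y.1) x w
        = ∑ i ∈ range N, ∑ j ∈ range N, (Ring.choose α i * Ring.choose β j) •
          Ring.choose (((i - m : ℤ)) : ℂ) k • S.mode x ((i - m) + (j - n) - k) w := by
  filter_upwards [S.eventually_mode_eq_zero (m + n + k) x w, eventually_ge_atTop k] with N hN' hk
  rw [sum_range_sum_range_eq_sum_antidiagonal]
  · have h1 : ∀ y ∈ antidiagonal k, S.residue (α + β - y.2) (m + n + y.1) x w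
        = ∑ q ∈ range N, (if y.2 ≤ q then Ring.choose (α + β - y.2) (q - y.2) else 0) •
            S.mode x (q - (m + n + k)) w := by
      intro y hy
      have hy' := mem_antidiagonal.1 hy
      -- The residue is cut off at t = N - y.2, so that its index shifted by y.2 runs up to N.
      obtain ⟨t, rfl⟩ := Nat.exists_eq_add_of_le (show y.2 ≤ N by omega)
      rw [S.residue_eq_sum_range _ _ _ _ t fun e he => hN' e (by push_cast; omega), sum_range_add,
        sum_eq_zero (s := range y.2), zero_add]
      · refine sum_congr rfl fun i _ => ?_
        rw [if_pos (by omega), add_tsub_cancel_left]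
        congr 2
        push_cast; omega
      · intro i hi
        rw [if_neg (by have := mem_range.1 hi; omega), zero_smul]
    rw [sum_congr rfl fun y hy => by rw [h1 y hy]]
    simp_rw [smul_sum]
    rw [sum_comm]
    refine sum_congr rfl fun q _ => ?_
    simp_rw [smul_smul]
    rw [← sum_smul, ← sum_antidiagonal_choose_mul_choose_add, sum_smul]
    refine sum_congr rfl fun z hz => ?_
    have hz' := mem_antidiagonal.1 hz
    congr 2
    · congr 1; push_cast; ring
    · omega
  · intro i j hij
    rw [hN' _ (by omega), smul_zero, smul_zero]

/-! ### The Jacobi identity in terms of residues -/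

theorem choose_intCast (l : ℤ) (i : ℕ) : ((Ring.choose l i : ℤ) : ℂ) = Ring.choose (l : ℂ) i :=
  Ring.map_choose (Int.castRingHom ℂ) l i

/-- The Jacobi identity with sums truncated uniformly in `m' ≥ -m` and `n' ≥ -n`. -/
theorem eventually_jacobi {p q : ℕ} {u v : V} (hu : u ∈ S.grade p) (hv : v ∈ S.grade q) (w : V)
    (l m n : ℤ) : ∀ᶠ N : ℕ in atTop, ∀ m' n' : ℤ, -m ≤ m' → -n ≤ n' →
      ∑ i ∈ range N, ((-1 : ℂ) ^ i * Ring.choose (l : ℂ) i) •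
          S.mode u (m' + l - i) (S.mode v (n' + i) w)
        - (-1 : ℂ) ^ (p * q) • ∑ i ∈ range N,
          ((-1 : ℂ) ^ l * (-1 : ℂ) ^ i * Ring.choose (l : ℂ) i) •
          S.mode v (n' + l - i) (S.mode u (m' + i) w)
      = ∑ i ∈ range N, Ring.choose (m' : ℂ) i • S.mode (S.mode u (l + i) v) (m' + n' - i) w := by
  filter_upwards [S.eventually_mode_eq_zero n v w, S.eventually_mode_eq_zero m u w,
    S.eventually_mode_eq_zero (-l) u v] with N hv' hu' huv m' n' hm hn
  have key := S.jacobi p q u hu v hv w l m' n'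
  simp only [choose_intCast] at key
  rw [finsum_eq_sum_of_support_subset (s := range N),
    finsum_eq_sum_of_support_subset (s := range N),
    finsum_eq_sum_of_support_subset (s := range N)] at key
  · exact key
  all_goals
    intro i hi
    by_contra h
    simp only [coe_range, Set.mem_Iio, not_lt] at h
    refine hi ?_
  · change _ • S.mode (S.mode u (l + i) v) _ _ = 0
    rw [huv _ (by omega), mode_zero_left, smul_zero]
  · change _ • S.mode v _ (S.mode u (m' + i) w) = 0
    rw [hu' _ (by omega), mode_zero_right, smul_zero]
  · change _ • S.mode u _ (S.mode v (n' + i) w) = 0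
    rw [hv' _ (by omega), mode_zero_right, smul_zero]

/-- The Jacobi identity paired with
`(1 + z₁)^α (1 + z₂)^β z₁^(-m) z₂^(-n) (z₁ - z₂)^l`. -/
theorem eventually_jacobi_residue {p q : ℕ} {u v : V} (hu : u ∈ S.grade p) (hv : v ∈ S.grade q)
    (w : V) (α β : ℂ) (l m n : ℤ) : ∀ᶠ I : ℕ in atTop,
      ∑ i ∈ range I, ((-1 : ℂ) ^ i * Ring.choose (l : ℂ) i) •
          S.residue α (m - l + i) u (S.residue β (n - i) v w)
        - (-1 : ℂ) ^ (p * q) • ∑ i ∈ range I,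
          ((-1 : ℂ) ^ l * (-1 : ℂ) ^ i * Ring.choose (l : ℂ) i) •
          S.residue β (n - l + i) v (S.residue α (m - i) u w)
      = ∑ i ∈ range I, ∑ y ∈ antidiagonal i, (Ring.choose (-m : ℂ) y.1 * Ring.choose α y.2) •
          S.residue (α + β - y.2) (m + n + y.1) (S.mode u (l + i) v) w := by
  filter_upwards [S.eventually_jacobi hu hv w l m n] with I hI
  -- The cutoff `I` works for all modes m' ≥ -m and n' ≥ -n at once, so the cutoff `N` of the
  -- binomial series can be chosen after it.
  have h1 : ∀ᶠ N : ℕ in atTop, ∀ i ∈ range I, _ := (eventually_all_finset (range I)).2 fun i _ =>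
    S.eventually_residue_residue_eq_sum α β (m - l + i) (n - i) u v w
  have h2 : ∀ᶠ N : ℕ in atTop, ∀ i ∈ range I, _ := (eventually_all_finset (range I)).2 fun i _ =>
    S.eventually_residue_residue_eq_sum β α (n - l + i) (m - i) v u w
  have h3 : ∀ᶠ N : ℕ in atTop, ∀ i ∈ range I, _ := (eventually_all_finset (range I)).2 fun i _ =>
    S.eventually_sum_residue_eq_sum α β m n (S.mode u (l + i) v) w i
  obtain ⟨N, h1, h2, h3⟩ := (h1.and (h2.and h3)).exists
  have e1 : ∑ i ∈ range I, ((-1 : ℂ) ^ i * Ring.choose (l : ℂ) i) •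
          S.residue α (m - l + i) u (S.residue β (n - i) v w)
      = ∑ a ∈ range N, ∑ b ∈ range N, (Ring.choose α a * Ring.choose β b) •
        ∑ i ∈ range I, ((-1 : ℂ) ^ i * Ring.choose (l : ℂ) i) •
          S.mode u ((a - m) + l - i) (S.mode v ((b - n) + i) w) := by
    rw [sum_congr rfl fun i hi => by rw [h1 i hi]]
    simp_rw [smul_sum]
    rw [sum_comm]
    refine sum_congr rfl fun a _ => ?_
    rw [sum_comm]
    refine sum_congr rfl fun b _ => sum_congr rfl fun i _ => ?_
    rw [smul_comm]
    congr 3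
    · ring
    · congr 1; ring
  have e2 : ∑ i ∈ range I, ((-1 : ℂ) ^ l * (-1 : ℂ) ^ i * Ring.choose (l : ℂ) i) •
          S.residue β (n - l + i) v (S.residue α (m - i) u w)
      = ∑ a ∈ range N, ∑ b ∈ range N, (Ring.choose α a * Ring.choose β b) •
        ∑ i ∈ range I, ((-1 : ℂ) ^ l * (-1 : ℂ) ^ i * Ring.choose (l : ℂ) i) •
          S.mode v ((b - n) + l - i) (S.mode u ((a - m) + i) w) := by
    rw [sum_congr rfl fun i hi => by rw [h2 i hi]]
    simp_rw [smul_sum]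
    rw [sum_comm, sum_comm (s := range N) (t := range N)]
    refine sum_congr rfl fun b _ => ?_
    rw [sum_comm]
    refine sum_congr rfl fun a _ => sum_congr rfl fun i _ => ?_
    rw [smul_comm, mul_comm (Ring.choose β b)]
    congr 3
    · ring
    · congr 1; ring
  have e3 : ∑ i ∈ range I, ∑ y ∈ antidiagonal i, (Ring.choose (-m : ℂ) y.1 * Ring.choose α y.2) •
          S.residue (α + β - y.2) (m + n + y.1) (S.mode u (l + i) v) w
      = ∑ a ∈ range N, ∑ b ∈ range N, (Ring.choose α a * Ring.choose β b) •
        ∑ i ∈ range I, Ring.choose (((a - m : ℤ)) : ℂ) i •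
          S.mode (S.mode u (l + i) v) ((a - m) + (b - n) - i) w := by
    rw [sum_congr rfl h3]
    simp_rw [smul_sum]
    rw [sum_comm]
    refine sum_congr rfl fun a _ => ?_
    rw [sum_comm]
  rw [e1, e2, e3, smul_sum, ← sum_sub_distrib]
  refine sum_congr rfl fun a _ => ?_
  rw [smul_sum, ← sum_sub_distrib]
  refine sum_congr rfl fun b _ => ?_
  rw [smul_comm, ← smul_sub, hI _ _ (by omega) (by omega)]

/-! ### Weights as eigenvalues of L(0) -/

/-- The eigenspace of `L(0)` with eigenvalue `w`. -/
def weightSpace (w : ℂ) : Submodule ℂ V :=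
  Module.End.eigenspace (S.modeHom 1 S.conformal) w

variable {S} in
theorem mem_weightSpace {w : ℂ} {x : V} :
    x ∈ S.weightSpace w ↔ S.mode S.conformal 1 x = w • x := Module.End.mem_eigenspace_iff

theorem mem_weightSpace_of_mem_grade {n : ℕ} {x : V} (hx : x ∈ S.grade n) :
    x ∈ S.weightSpace ((n : ℂ) / 2) := mem_weightSpace.2 (S.L_zero n x hx)

theorem decomposition_symm_modeHom_conformal (x : V) (n : ℕ) :
    S.decomposition.symm (S.modeHom 1 S.conformal x) n
      = ((n : ℂ) / 2) • S.decomposition.symm x n := by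
  have hx : x ∈ ⨆ i, S.grade i := by
    rw [S.isInternal.submodule_iSup_eq_top]; trivial
  induction hx using Submodule.iSup_induction' with
  | mem i x hx =>
    rw [modeHom_apply, show S.mode S.conformal 1 x = _ from S.L_zero i x hx, map_smul,
      S.decomposition_symm_of_mem hx, DirectSum.smul_apply]
    by_cases h : i = n
    · subst h; rfl
    · rw [DirectSum.lof_eq_of, DirectSum.of_eq_of_ne _ _ _ (Ne.symm h), smul_zero, smul_zero]
  | zero => simp
  | add x y _ _ hx hy => simp only [map_add, DirectSum.add_apply, hx, hy, smul_add]

/-- L(0) acts on the homogeneous components by distinct scalars, so an eigenvector has at most one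
nonzero component. Complex weights let u_n v have weight wt u + wt v - n - 1 even when this is
negative; the vector is then zero. -/
theorem eq_zero_or_mem_grade_of_mem_weightSpace {w : ℂ} {x : V} (hx : x ∈ S.weightSpace w) :
    x = 0 ∨ ∃ n : ℕ, w = (n : ℂ) / 2 ∧ x ∈ S.grade n := by
  by_cases h0 : x = 0
  · exact Or.inl h0
  right
  have key (n : ℕ) : S.decomposition.symm x n = 0 ∨ w = (n : ℂ) / 2 := by
    have h := S.decomposition_symm_modeHom_conformal x n
    rw [modeHom_apply, mem_weightSpace.1 hx, map_smul, DirectSum.smul_apply, ← sub_eq_zero,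
      ← sub_smul, smul_eq_zero, sub_eq_zero] at h
    exact h.symm
  have hne : S.decomposition.symm x ≠ 0 := by simpa using h0
  obtain ⟨n, hn⟩ := DFinsupp.ne_iff.1 hne
  have hw := (key n).resolve_left hn
  refine ⟨n, hw, ?_⟩
  have : S.decomposition.symm x
      = DirectSum.lof ℂ ℕ (fun n => S.grade n) n (S.decomposition.symm x n) := by
    refine DFinsupp.ext fun m => ?_
    by_cases h : m = n
    · subst h
      exact (DirectSum.of_eq_same (β := fun n => S.grade n) m _).symm
    · refine Eq.trans ?_ (DirectSum.of_eq_of_ne (β := fun n => S.grade n) n m _ h).symm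
      refine (key m).resolve_right fun hm => h ?_
      rw [hw] at hm
      have : (n : ℂ) = m := by linear_combination 2 * hm
      exact_mod_cast this.symm
  rw [LinearEquiv.symm_apply_eq] at this
  rw [this]
  exact (DirectSum.coeLinearMap_lof S.grade n _).symm ▸ Subtype.property _

/-- The commutator formula. -/
theorem eventually_commutator {p q : ℕ} {u v : V} (hu : u ∈ S.grade p) (hv : v ∈ S.grade q) (w : V)
    (m n : ℤ) : ∀ᶠ N : ℕ in atTop,
      S.mode u m (S.mode v n w) - (-1 : ℂ) ^ (p * q) • S.mode v n (S.mode u m w)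
      = ∑ i ∈ range N, Ring.choose (m : ℂ) i • S.mode (S.mode u i v) (m + n - i) w := by
  filter_upwards [S.eventually_jacobi hu hv w 0 (-m) (-n), eventually_ge_atTop 1] with N hN h1
  have h := hN m n (by omega) (by omega)
  obtain ⟨N, rfl⟩ := Nat.exists_eq_add_of_le' h1
  simp only [zero_add] at h
  rw [← h, sum_range_succ', sum_range_succ']
  simp

/-- In the commutator formula for ω_1 = L(0) only two terms survive: (L(-1)u)_{n+1} = -(n + 1) u_n
and (L(0)u)_n = (wt u) u_n. -/
theorem mode_conformal_one_mode {p : ℕ} {u : V} (hu : u ∈ S.grade p) (v : V) (n : ℤ) :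
    S.mode S.conformal 1 (S.mode u n v)
      = S.mode u n (S.mode S.conformal 1 v) + ((p : ℂ) / 2 - n - 1) • S.mode u n v := by
  obtain ⟨N, hN, h2⟩ := ((S.eventually_commutator S.conformal_mem hu v 1 n).and
    (eventually_ge_atTop 2)).exists
  obtain ⟨N, rfl⟩ := Nat.exists_eq_add_of_le' h2
  rw [sum_range_succ', sum_range_succ', sum_eq_zero, zero_add] at hN
  · have h0 : S.mode (S.mode S.conformal 0 u) (1 + n) v = (-(n : ℂ) - 1) • S.mode u n v := by
      have := S.derivative u (1 + n) v
      refine this.trans ?_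
      rw [show 1 + n - 1 = n by ring, show (-((1 + n : ℤ) : ℂ)) = -(n : ℂ) - 1 by push_cast; ring]
      rfl
    have h1 : S.mode (S.mode S.conformal 1 u) n v = ((p : ℂ) / 2) • S.mode u n v := by
      rw [show S.mode S.conformal 1 u = _ from S.L_zero p u hu, mode_smul_left]
    have he : Even (4 * p) := ⟨2 * p, by ring⟩
    rw [he.neg_one_pow, one_smul, sub_eq_iff_eq_add'] at hN
    rw [hN]
    simp only [zero_add, Nat.cast_one, Nat.cast_zero, Int.cast_one, Ring.choose_one_right,
      Ring.choose_zero_right, one_smul, sub_zero, add_sub_cancel_left, h0, h1]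
    rw [← add_smul]
    congr 2; ring
  · intro i _
    have : Ring.choose ((1 : ℤ) : ℂ) (i + 1 + 1) = 0 := by
      rw [show ((1 : ℤ) : ℂ) = ((1 : ℕ) : ℂ) by norm_num, Ring.choose_natCast,
        Nat.choose_eq_zero_of_lt (by omega), Nat.cast_zero]
    rw [this, zero_smul]

theorem mode_mem_weightSpace {a b : ℂ} {u v : V} (hu : u ∈ S.weightSpace a)
    (hv : v ∈ S.weightSpace b) (n : ℤ) : S.mode u n v ∈ S.weightSpace (a + b - n - 1) := by
  obtain rfl | ⟨p, rfl, hp⟩ := S.eq_zero_or_mem_grade_of_mem_weightSpace hu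
  · rw [mode_zero_left]; exact zero_mem _
  · rw [mem_weightSpace, S.mode_conformal_one_mode hp, mem_weightSpace.1 hv, mode_smul_right,
      ← add_smul]
    congr 1; ring

/-! ### Automorphisms and the eigenspaces of gσ -/

section Automorphism

variable {S} {g : V ≃ₗ[ℂ] V}

theorem IsAutomorphism.map_mode (hg : S.IsAutomorphism g) (u v : V) (n : ℤ) :
    g (S.mode u n v) = S.mode (g u) n (g v) := by
  simpa using hg.conj_mode u n (g v)

/-- Conjugating 𝟏_{-1} = Id by g shows that (g𝟏)_{-1} is the identity; apply it to 𝟏. -/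
theorem IsAutomorphism.map_vacuum (hg : S.IsAutomorphism g) : g S.vacuum = S.vacuum := by
  have h1 : S.mode (g S.vacuum) (-1) S.vacuum = S.vacuum := by
    rw [← hg.conj_mode, show S.mode S.vacuum (-1) _ = _ from S.vacuum_mode _ _, if_pos rfl,
      LinearEquiv.apply_symm_apply]
  exact (S.mode_neg_one_vacuum _).symm.trans h1

/-- Since g fixes ω, it commutes with L(0). -/
theorem IsAutomorphism.map_mem_grade (hg : S.IsAutomorphism g) {n : ℕ} {x : V}
    (hx : x ∈ S.grade n) : g x ∈ S.grade n := by
  have : g x ∈ S.weightSpace ((n : ℂ) / 2) := by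
    have h := hg.map_mode S.conformal x 1
    rw [mem_weightSpace, ← map_smul, ← mem_weightSpace.1 (S.mem_weightSpace_of_mem_grade hx), h,
      hg.map_conformal]
  obtain h | ⟨m, hm, h⟩ := S.eq_zero_or_mem_grade_of_mem_weightSpace this
  · rw [h]; exact zero_mem _
  · have : (n : ℂ) = m := by linear_combination 2 * hm
    rwa [Nat.cast_injective this]

variable (S) in
theorem iSup_grade : ⨆ n, S.grade n = ⊤ := S.isInternal.submodule_iSup_eq_top

theorem mul_parity_of_mem_grade {n : ℕ} {x : V} (hx : x ∈ S.grade n) :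
    (g * S.parity) x = (-1 : ℂ) ^ n • g x := by
  rw [LinearEquiv.mul_apply, S.parity_of_mem hx, map_smul]

theorem IsAutomorphism.mul_parity_mem_grade (hg : S.IsAutomorphism g) {n : ℕ} {x : V}
    (hx : x ∈ S.grade n) : (g * S.parity) x ∈ S.grade n := by
  rw [mul_parity_of_mem_grade hx]
  exact Submodule.smul_mem _ _ (hg.map_mem_grade hx)

/-- The sign σ is multiplicative: twice the weight of u_n v is p + q - 2n - 2, which has the parity
of p + q. -/
theorem IsAutomorphism.mul_parity_mode (hg : S.IsAutomorphism g) {p q : ℕ} {u v : V}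
    (hu : u ∈ S.grade p) (hv : v ∈ S.grade q) (n : ℤ) :
    (g * S.parity) (S.mode u n v) = S.mode ((g * S.parity) u) n ((g * S.parity) v) := by
  rw [mul_parity_of_mem_grade hu, mul_parity_of_mem_grade hv, mode_smul_left, mode_smul_right,
    smul_smul, ← hg.map_mode]
  obtain h | ⟨N, hN, h⟩ := S.eq_zero_or_mem_grade_of_mem_weightSpace
    (S.mode_mem_weightSpace (S.mem_weightSpace_of_mem_grade hu)
      (S.mem_weightSpace_of_mem_grade hv) n)
  · simp [h]
  · rw [mul_parity_of_mem_grade h]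
    have h1 : (N : ℂ) = p + q - 2 * n - 2 := by linear_combination -2 * hN
    have h2 : (N : ℤ) = p + q - 2 * n - 2 := by exact_mod_cast h1
    have h3 : Even N ↔ Even (p + q) := by
      simp only [Nat.even_iff]; omega
    rw [← pow_add, neg_one_pow_congr h3]

theorem linearEquiv_ext_grade {f f' : V ≃ₗ[ℂ] V} (h : ∀ n, ∀ x ∈ S.grade n, f x = f' x) :
    f = f' := by
  have : (⊤ : Submodule ℂ V) ≤ LinearMap.eqLocus (f : V →ₗ[ℂ] V) (f' : V →ₗ[ℂ] V) := by
    rw [← S.iSup_grade]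
    exact iSup_le fun n x hx => h n x hx
  exact LinearEquiv.ext fun x => this (Submodule.mem_top (x := x))

/-- g preserves the grading, so it commutes with σ, and σ² = 1. -/
theorem IsAutomorphism.twistOrder_pos (hg : S.IsAutomorphism g) (hfin : IsOfFinOrder g) :
    0 < S.twistOrder g := by
  have h1 : Commute g S.parity := linearEquiv_ext_grade (S := S) fun n x hx => by
    rw [mul_parity_of_mem_grade hx, LinearEquiv.mul_apply, S.parity_of_mem (hg.map_mem_grade hx)]
  have h2 : IsOfFinOrder S.parity := isOfFinOrder_iff_pow_eq_one.2 ⟨2, by norm_num,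
    linearEquiv_ext_grade (S := S) fun n x hx => by
      rw [pow_two, LinearEquiv.mul_apply, S.parity_of_mem hx, map_smul, S.parity_of_mem hx,
        smul_smul, ← mul_pow]
      simp⟩
  exact (h1.isOfFinOrder_mul hfin h2).orderOf_pos

theorem mem_eigen {r : ℕ} {u : V} : u ∈ S.eigen g r ↔ (g * S.parity) u
    = Complex.exp (2 * Real.pi * Complex.I * r / S.twistOrder g) • u :=
  Module.End.mem_eigenspace_iff

theorem mem_eigen_zero {u : V} : u ∈ S.eigen g 0 ↔ (g * S.parity) u = u := by
  simp [mem_eigen]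

theorem IsAutomorphism.mode_mem_eigen (hg : S.IsAutomorphism g) {p q r s : ℕ} {u v : V}
    (hu : u ∈ S.grade p) (hv : v ∈ S.grade q) (hur : u ∈ S.eigen g r) (hvs : v ∈ S.eigen g s)
    (n : ℤ) : S.mode u n v ∈ S.eigen g (r + s) := by
  rw [mem_eigen, hg.mul_parity_mode hu hv, mem_eigen.1 hur, mem_eigen.1 hvs, mode_smul_left,
    mode_smul_right, smul_smul, ← Complex.exp_add]
  congr 2; push_cast; ring

theorem IsAutomorphism.vacuum_mem_eigen (hg : S.IsAutomorphism g) : S.vacuum ∈ S.eigen g 0 := by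
  rw [mem_eigen_zero, mul_parity_of_mem_grade S.vacuum_mem, hg.map_vacuum]; simp

theorem IsAutomorphism.conformal_mem_eigen (hg : S.IsAutomorphism g) :
    S.conformal ∈ S.eigen g 0 := by
  rw [mem_eigen_zero, mul_parity_of_mem_grade S.conformal_mem, hg.map_conformal]
  norm_num

theorem eigen_add_mul (hT : 0 < S.twistOrder g) (r k : ℕ) :
    S.eigen g (r + S.twistOrder g * k) = S.eigen g r := by
  have hT' : (S.twistOrder g : ℂ) ≠ 0 := by exact_mod_cast hT.ne'
  have : Complex.exp (2 * Real.pi * Complex.I * (r + S.twistOrder g * k : ℕ) / S.twistOrder g)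
      = Complex.exp (2 * Real.pi * Complex.I * r / S.twistOrder g) := by
    rw [Complex.exp_eq_exp_iff_exists_int]
    exact ⟨k, by push_cast; field_simp⟩
  rw [eigen, this, eigen]

theorem eigen_mod (hT : 0 < S.twistOrder g) (r : ℕ) :
    S.eigen g (r % S.twistOrder g) = S.eigen g r := by
  conv_rhs => rw [← Nat.mod_add_div r (S.twistOrder g)]
  rw [eigen_add_mul hT]

/-- The space is spanned by the homogeneous eigenvectors of `g σ`. -/
theorem IsAutomorphism.eq_top_of_homogeneous (hg : S.IsAutomorphism g) (hT : 0 < S.twistOrder g)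
    (W : Submodule ℂ V)
    (hW : ∀ n r : ℕ, r < S.twistOrder g → ∀ x ∈ S.grade n, x ∈ S.eigen g r → x ∈ W) : W = ⊤ := by
  rw [eq_top_iff, ← S.iSup_grade]
  refine iSup_le fun n x hx => ?_
  set T := S.twistOrder g with hTdef
  have hT' : (T : ℂ) ≠ 0 := by exact_mod_cast hT.ne'
  have hprim := Complex.isPrimitiveRoot_exp T hT.ne'
  set ζ := Complex.exp (2 * Real.pi * Complex.I / T) with hζ
  have hζ0 : ζ ≠ 0 := Complex.exp_ne_zero _
  have hexp (r : ℕ) : Complex.exp (2 * Real.pi * Complex.I * r / T) = ζ ^ r := by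
    rw [hζ, ← Complex.exp_nat_mul]; congr 1; ring
  have hpowT : (g * S.parity) ^ T = 1 := pow_orderOf_eq_one _
  have hgr (k : ℕ) : ((g * S.parity) ^ k) x ∈ S.grade n := by
    induction k with
    | zero => simpa using hx
    | succ k ih =>
      rw [pow_succ', LinearEquiv.mul_apply]
      exact hg.mul_parity_mem_grade ih
  -- Summed over k, these give T times the component of x in V^{r*}.
  let f (r k : ℕ) : V := ((ζ ^ r)⁻¹) ^ k • ((g * S.parity) ^ k) x
  have hf (r : ℕ) (hr : r ∈ range T) : ∑ k ∈ range T, f r k ∈ W := by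
    refine hW n r (mem_range.1 hr) _ (sum_mem fun k _ => Submodule.smul_mem _ _ (hgr k)) ?_
    rw [mem_eigen, ← hTdef, hexp, map_sum]
    have h1 (k : ℕ) : (g * S.parity) (f r k) = ζ ^ r • f r (k + 1) := by
      have h : ((g * S.parity) ^ (k + 1)) x = (g * S.parity) (((g * S.parity) ^ k) x) := by
        rw [pow_succ']; rfl
      simp only [f]
      rw [map_smul, h, pow_succ' _ k, smul_smul, ← mul_assoc,
        mul_inv_cancel₀ (pow_ne_zero _ hζ0), one_mul]
    simp_rw [h1]
    rw [← smul_sum]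
    congr 1
    have h2 : f r T = f r 0 := by
      simp only [f, hpowT, pow_zero]
      rw [inv_pow, ← pow_mul, mul_comm, pow_mul, hprim.pow_eq_one, one_pow, inv_one]
    have h3 := sum_range_succ (f r) T
    rw [sum_range_succ', h2] at h3
    exact add_right_cancel h3
  -- Summed over r, only k = 0 survives; every other k gives a full geometric sum of a nontrivial
  -- T-th root of unity.
  have hsum : ∑ r ∈ range T, ∑ k ∈ range T, f r k = (T : ℂ) • x := by
    rw [sum_comm, sum_eq_single_of_mem 0 (mem_range.2 hT)]
    · simp [f, Nat.cast_smul_eq_nsmul]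
    · intro k hk hk0
      have hne : (ζ ^ k)⁻¹ ≠ 1 := by
        rw [Ne, inv_eq_one]
        exact hprim.pow_ne_one_of_pos_of_lt hk0 (mem_range.1 hk)
      have h1 (r : ℕ) : f r k = ((ζ ^ k)⁻¹) ^ r • ((g * S.parity) ^ k) x := by
        simp only [f]
        rw [inv_pow, inv_pow, pow_right_comm]
      simp_rw [h1]
      rw [← sum_smul, geom_sum_eq hne, inv_pow, pow_right_comm, hprim.pow_eq_one]
      simp
  have := W.smul_mem (T : ℂ)⁻¹ (hsum ▸ sum_mem hf)
  rwa [inv_smul_smul₀ hT'] at this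

end Automorphism

end VertexOperatorSuperalgebra

/-! ### Calculus of residues -/

theorem succ_mul_choose_succ (α : ℂ) (i : ℕ) :
    ((i : ℂ) + 1) * Ring.choose α (i + 1) = (α - i) * Ring.choose α i := by
  have h := Ring.choose_smul_choose α (Nat.le_succ i)
  rw [nsmul_eq_mul, Nat.succ_eq_add_one, Nat.choose_succ_self_right, add_tsub_cancel_left,
    Ring.choose_one_right] at h
  push_cast at h
  rw [h]; ring

namespace VertexOperatorSuperalgebra

variable {V : Type*} [AddCommGroup V] [Module ℂ V] (S : VertexOperatorSuperalgebra V)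

/-- This is (1 + z) z^(-k-1) = z^(-k-1) + z^(-k). -/
theorem residue_add_one (α : ℂ) (k : ℤ) (u v : V) :
    S.residue (α + 1) (k + 1) u v = S.residue α (k + 1) u v + S.residue α k u v := by
  obtain ⟨N, hN⟩ := (S.eventually_mode_eq_zero k u v).exists
  rw [S.residue_eq_sum_range _ _ _ _ (N + 1) fun n hn => hN n (by push_cast at hn; omega),
    S.residue_eq_sum_range _ (k + 1) _ _ (N + 1) fun n hn => hN n (by push_cast at hn; omega),
    S.residue_eq_sum_range _ k _ _ N hN, sum_range_succ', sum_range_succ', add_right_comm,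
    ← sum_add_distrib]
  congr 1
  · refine sum_congr rfl fun i _ => ?_
    rw [Ring.choose_succ_succ, add_comm (Ring.choose α i), add_smul]
    congr 3
    push_cast; ring
  · rw [Ring.choose_zero_right, Ring.choose_zero_right]

theorem mode_mode_conformal_zero (u v : V) (n : ℤ) :
    S.mode (S.mode S.conformal 0 u) n v = (-(n : ℂ)) • S.mode u (n - 1) v := S.derivative u n v

/-- Integration by parts against `(1 + z)^(α + 1) z^(-k)`. -/
theorem smul_residue_eq (α : ℂ) (k : ℤ) (u v : V) :
    (k : ℂ) • S.residue α (k + 1) u v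
      = S.residue (α + 1) k (S.mode S.conformal 0 u) v + (α + 1 - k) • S.residue α k u v := by
  obtain ⟨N, hN⟩ := (S.eventually_mode_eq_zero k u v).exists
  rw [S.residue_eq_sum_range _ (k + 1) _ _ (N + 1) fun n hn => hN n (by push_cast at hn; omega),
    S.residue_eq_sum_range _ k (S.mode _ _ _) _ (N + 1) fun n hn => by
      rw [mode_mode_conformal_zero, hN (n - 1) (by push_cast at hn; omega), smul_zero],
    S.residue_eq_sum_range _ k _ _ N hN, sum_range_succ', sum_range_succ' _ N, add_right_comm,
    smul_add, smul_sum, smul_sum, ← sum_add_distrib]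
  congr 1
  · refine sum_congr rfl fun i _ => ?_
    rw [mode_mode_conformal_zero, Ring.choose_succ_succ]
    have e1 : (((i + 1 : ℕ) : ℤ) - (k + 1)) = i - k := by push_cast; ring
    have e2 : (((i + 1 : ℕ) : ℤ) - k - 1) = i - k := by push_cast; ring
    rw [e1, e2, smul_smul, smul_smul, smul_smul, ← add_smul]
    congr 1
    push_cast
    linear_combination succ_mul_choose_succ α i
  · rw [mode_mode_conformal_zero, Ring.choose_zero_right, Ring.choose_zero_right, one_smul,
      one_smul, show ((0 : ℕ) : ℤ) - (k + 1) = ((0 : ℕ) : ℤ) - k - 1 by ring]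
    congr 1
    push_cast; ring

theorem residue_one_vacuum (α : ℂ) (u : V) : S.residue α 1 u S.vacuum = u := by
  rw [S.residue_eq_sum_range _ _ _ _ 1 fun n hn =>
    S.mode_vacuum_of_nonneg u n (by push_cast at hn; omega)]
  simpa using! S.mode_neg_one_vacuum u

/-- Only u_{-2}𝟏 = L(-1)u and u_{-1}𝟏 = u contribute. With α = wt u this identifies u ∘_g 𝟏 for u ∈
V^{0*}. -/
theorem residue_two_vacuum (α : ℂ) (u : V) :
    S.residue α 2 u S.vacuum = S.mode S.conformal 0 u + α • u := by
  rw [S.residue_eq_sum_range _ _ _ _ 2 fun n hn =>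
    S.mode_vacuum_of_nonneg u n (by push_cast at hn; omega), sum_range_succ, sum_range_one]
  have h1 : S.mode (S.mode S.conformal 0 u) (-1) S.vacuum = S.mode S.conformal 0 u :=
    S.mode_neg_one_vacuum _
  have h2 : S.mode u (-1) S.vacuum = u := S.mode_neg_one_vacuum u
  rw [mode_mode_conformal_zero] at h1
  rw [Ring.choose_zero_right, Ring.choose_one_right, ← h1]
  norm_num [h2]

theorem eventually_commutator_residue {p q : ℕ} {u v : V} (hu : u ∈ S.grade p)
    (hv : v ∈ S.grade q) (w : V) (α β : ℂ) (m n : ℤ) : ∀ᶠ I : ℕ in atTop,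
      S.residue α m u (S.residue β n v w)
        - (-1 : ℂ) ^ (p * q) • S.residue β n v (S.residue α m u w)
      = ∑ i ∈ range I, ∑ y ∈ antidiagonal i, (Ring.choose (-m : ℂ) y.1 * Ring.choose α y.2) •
          S.residue (α + β - y.2) (m + n + y.1) (S.mode u i v) w := by
  filter_upwards [S.eventually_jacobi_residue hu hv w α β 0 m n, eventually_ge_atTop 1] with I h hI
  obtain ⟨I, rfl⟩ := Nat.exists_eq_add_of_le' hI
  simp only [zero_add] at h
  rw [← h, sum_range_succ' _ I, sum_range_succ' _ I]
  simp

/-- The case l = -k, m = 0 of the Jacobi identity: without a power of z₁, only (1 + z₂ + z₀)^α is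
expanded in z₀. -/
theorem eventually_iterate_residue {p q : ℕ} {u v : V} (hu : u ∈ S.grade p)
    (hv : v ∈ S.grade q) (w : V) (α β : ℂ) (k n : ℤ) : ∀ᶠ I : ℕ in atTop,
      ∑ i ∈ range I, Ring.choose α i • S.residue (α + β - i) n (S.mode u (i - k) v) w
      = ∑ i ∈ range I, ((-1 : ℂ) ^ i * Ring.choose (-k : ℂ) i) •
          S.residue α (k + i) u (S.residue β (n - i) v w)
        - (-1 : ℂ) ^ (p * q) • ∑ i ∈ range I,
          ((-1 : ℂ) ^ (-k) * (-1 : ℂ) ^ i * Ring.choose (-k : ℂ) i) •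
          S.residue β (n + k + i) v (S.residue α (-i) u w) := by
  filter_upwards [S.eventually_jacobi_residue hu hv w α β (-k) 0 n] with I h
  simp only [zero_sub, sub_neg_eq_add, zero_add, Int.cast_neg, Int.cast_zero,
    neg_zero] at h
  rw [h]
  refine sum_congr rfl fun i _ => ?_
  rw [sum_eq_single_of_mem (0, i) (by simp)]
  · rw [Ring.choose_zero_right, one_mul, Nat.cast_zero, add_zero, neg_add_eq_sub]
  · rintro ⟨a, b⟩ hab hne
    rw [HasAntidiagonal.mem_antidiagonal] at hab
    have : 0 < a := Nat.pos_of_ne_zero fun h0 => hne (by subst h0; simpa using hab)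
    rw [Ring.choose_zero_pos ℂ this, zero_mul, zero_smul]

/-! ### Elements of O_g(V) -/

variable (g : V ≃ₗ[ℂ] V)

/-- The vectors of weight `w` in the eigenspace `V^{r*}`. -/
def homogeneous (w : ℂ) (r : ℕ) : Submodule ℂ V := S.weightSpace w ⊓ S.eigen g r

/-- The exponent `wt u - 1 + δ_r + r / T` of `1 + z` in `u ∘_g v`. -/
def circExponent (w : ℂ) (r : ℕ) : ℂ := w - 1 + (if r = 0 then 1 else 0) + r / S.twistOrder g

/-- The exponent `1 + δ_r` of `z⁻¹` in `u ∘_g v`. -/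
def circPole (r : ℕ) : ℤ := 1 + if r = 0 then 1 else 0

theorem circExponent_zero (w : ℂ) : S.circExponent g w 0 = w := by simp [circExponent]

theorem circPole_zero : circPole 0 = 2 := rfl

theorem circPole_of_pos {r : ℕ} (hr : 0 < r) : circPole r = 1 := by simp [circPole, hr.ne']

theorem circPole_pos (r : ℕ) : 0 < circPole r := by
  unfold circPole; split_ifs <;> norm_num

variable {S g}

theorem homogeneous_of_mem {n r : ℕ} {x : V} (hx : x ∈ S.grade n) (hr : x ∈ S.eigen g r) :
    x ∈ S.homogeneous g ((n : ℂ) / 2) r := ⟨S.mem_weightSpace_of_mem_grade hx, hr⟩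

theorem IsAutomorphism.mode_mem_homogeneous (hg : S.IsAutomorphism g) {a b : ℂ} {r s : ℕ} {u v : V}
    (hu : u ∈ S.homogeneous g a r) (hv : v ∈ S.homogeneous g b s) (n : ℤ) :
    S.mode u n v ∈ S.homogeneous g (a + b - n - 1) (r + s) := by
  refine ⟨S.mode_mem_weightSpace hu.1 hv.1 n, ?_⟩
  obtain rfl | ⟨p, rfl, hp⟩ := S.eq_zero_or_mem_grade_of_mem_weightSpace hu.1
  · rw [mode_zero_left]; exact zero_mem _
  obtain rfl | ⟨q, rfl, hq⟩ := S.eq_zero_or_mem_grade_of_mem_weightSpace hv.1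
  · rw [mode_zero_right]; exact zero_mem _
  exact hg.mode_mem_eigen hp hq hu.2 hv.2 n

theorem IsAutomorphism.conformal_mem_homogeneous (hg : S.IsAutomorphism g) :
    S.conformal ∈ S.homogeneous g 2 0 := by
  have := homogeneous_of_mem S.conformal_mem hg.conformal_mem_eigen
  norm_num at this
  exact this

theorem residue_mem_Og {w : ℂ} {r : ℕ} (hr : r < S.twistOrder g) {u : V}
    (hu : u ∈ S.homogeneous g w r) (v : V) :
    S.residue (S.circExponent g w r) (circPole r) u v ∈ S.Og g := by
  obtain rfl | ⟨p, rfl, hp⟩ := S.eq_zero_or_mem_grade_of_mem_weightSpace hu.1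
  · rw [map_zero, LinearMap.zero_apply]; exact zero_mem _
  · exact Submodule.subset_span ⟨p, r, u, v, hr, hp, hu.2, rfl⟩

/-- Integration by parts trades one more pole for L(-1)u, whose weight and hence exponent are larger
by one. The pole order is positive, so it can be divided out. -/
theorem IsAutomorphism.residue_add_mem_Og (hg : S.IsAutomorphism g) {r : ℕ}
    (hr : r < S.twistOrder g) (v : V) (m : ℕ) {w : ℂ} {u : V} (hu : u ∈ S.homogeneous g w r) :
    S.residue (S.circExponent g w r) (circPole r + m) u v ∈ S.Og g := by
  induction m generalizing w u with
  | zero => simpa using residue_mem_Og hr hu v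
  | succ m ih =>
    have hpos := circPole_pos r
    have hk : ((circPole r + m : ℤ) : ℂ) ≠ 0 := by
      exact_mod_cast (show circPole r + m ≠ 0 by omega)
    have hL : S.mode S.conformal 0 u ∈ S.homogeneous g (w + 1) r := by
      have := hg.mode_mem_homogeneous hg.conformal_mem_homogeneous hu 0
      rw [zero_add] at this
      convert this using 1
      push_cast
      congr 1; ring
    have hw : S.circExponent g (w + 1) r = S.circExponent g w r + 1 := by
      unfold circExponent; ring
    have h := S.smul_residue_eq (S.circExponent g w r) (circPole r + m) u v
    rw [← hw] at h
    have h' := (S.Og g).smul_mem ((circPole r + m : ℤ) : ℂ)⁻¹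
      (h ▸ add_mem (ih hL) (Submodule.smul_mem _ _ (ih hu)))
    rw [inv_smul_smul₀ hk] at h'
    rwa [show circPole r + ((m + 1 : ℕ) : ℤ) = circPole r + m + 1 by push_cast; ring]

theorem IsAutomorphism.residue_mem_Og_of_le (hg : S.IsAutomorphism g) {r : ℕ}
    (hr : r < S.twistOrder g) {w : ℂ} {u : V} (hu : u ∈ S.homogeneous g w r) (v : V) {m n : ℕ}
    (hnm : n ≤ m) {α : ℂ} {k : ℤ} (hα : α = S.circExponent g w r + n) (hk : k = circPole r + m) :
    S.residue α k u v ∈ S.Og g := by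
  subst hα hk
  induction n generalizing m with
  | zero => simpa using hg.residue_add_mem_Og hr v m hu
  | succ n ih =>
    obtain ⟨m, rfl⟩ := Nat.exists_eq_add_of_le' (show 1 ≤ m by omega)
    have h1 := ih (m := m + 1) (by omega)
    have h2 := ih (m := m) (by omega)
    have h := S.residue_add_one (S.circExponent g w r + n) (circPole r + m) u v
    rw [show circPole r + m + 1 = circPole r + ((m + 1 : ℕ) : ℤ) by push_cast; ring,
      show S.circExponent g w r + n + 1 = S.circExponent g w r + ((n + 1 : ℕ) : ℂ) by
        push_cast; ring] at h
    rw [h]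
    exact add_mem h1 h2

theorem mem_Og_of_mem_eigen {r : ℕ} (hr0 : 0 < r) (hr : r < S.twistOrder g) {w : ℂ} {u : V}
    (hu : u ∈ S.homogeneous g w r) : u ∈ S.Og g := by
  have := residue_mem_Og hr hu S.vacuum
  rwa [circPole_of_pos hr0, residue_one_vacuum] at this

theorem star_eq_residue (hT : 0 < S.twistOrder g) {w : ℂ} {u : V}
    (hu : u ∈ S.homogeneous g w 0) (v : V) : S.star g u v = S.residue w 1 u v := by
  obtain rfl | ⟨p, rfl, hp⟩ := S.eq_zero_or_mem_grade_of_mem_weightSpace hu.1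
  · simp
  · exact S.star_of_mem_zero g hT hp hu.2 v

theorem star_eq_zero (hT : 0 < S.twistOrder g) {r : ℕ} (hr : ¬ S.twistOrder g ∣ r) {u : V}
    (hu : u ∈ S.eigen g r) (v : V) : S.star g u v = 0 := by
  rw [← eigen_mod hT] at hu
  exact S.star_of_mem_pos g (Nat.pos_of_ne_zero fun h => hr (Nat.dvd_of_mod_eq_zero h))
    (Nat.mod_lt _ hT) hu v

theorem IsAutomorphism.residue_mem_eigen (hg : S.IsAutomorphism g) {a b : ℂ} {r s : ℕ} {u v : V}
    (hu : u ∈ S.homogeneous g a r) (hv : v ∈ S.homogeneous g b s) (α : ℂ) (k : ℤ) :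
    S.residue α k u v ∈ S.eigen g (r + s) := by
  obtain ⟨N, hN⟩ := (S.eventually_residue_eq_sum α k u v).exists
  rw [hN]
  exact sum_mem fun i _ => Submodule.smul_mem _ _ (hg.mode_mem_homogeneous hu hv _).2

/-- The condition on α + β makes α + β - i the weight of u_{i-k} v, so the left side of the iterate
formula is a sum of products *_g. Divisibility of r + s puts these vectors in V^{0*}. -/
theorem IsAutomorphism.eventually_star_residue (hg : S.IsAutomorphism g)
    (hT : 0 < S.twistOrder g) {p q r s : ℕ} {u v : V} (hu : u ∈ S.grade p) (hv : v ∈ S.grade q)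
    (hur : u ∈ S.eigen g r) (hvs : v ∈ S.eigen g s) (hrs : S.twistOrder g ∣ r + s) {α β : ℂ}
    {k : ℤ} (hαβ : α + β = (p : ℂ) / 2 + (q : ℂ) / 2 + k - 1) (w : V) : ∀ᶠ I : ℕ in atTop,
      S.star g (S.residue α k u v) w
      = ∑ i ∈ range I, ((-1 : ℂ) ^ i * Ring.choose (-k : ℂ) i) •
          S.residue α (k + i) u (S.residue β (1 - i) v w)
        - (-1 : ℂ) ^ (p * q) • ∑ i ∈ range I,
          ((-1 : ℂ) ^ (-k) * (-1 : ℂ) ^ i * Ring.choose (-k : ℂ) i) •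
          S.residue β (1 + k + i) v (S.residue α (-i) u w) := by
  filter_upwards [S.eventually_iterate_residue hu hv w α β k 1, S.eventually_residue_eq_sum α k u v]
    with I h1 h2
  rw [← h1, h2, map_sum, LinearMap.sum_apply]
  refine sum_congr rfl fun i _ => ?_
  have hm := hg.mode_mem_homogeneous (homogeneous_of_mem hu hur) (homogeneous_of_mem hv hvs) (i - k)
  obtain ⟨t, ht⟩ := hrs
  have he : S.eigen g (r + s) = S.eigen g 0 := by
    rw [ht, ← zero_add (S.twistOrder g * t), eigen_add_mul hT]
  rw [homogeneous, he] at hm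
  rw [map_smul, LinearMap.smul_apply, star_eq_residue hT hm, hαβ]
  congr 4
  push_cast; ring

end VertexOperatorSuperalgebra

/-! ### O_g(V) is a two-sided ideal for *_g -/

namespace VertexOperatorSuperalgebra

variable {V : Type*} [AddCommGroup V] [Module ℂ V] {S : VertexOperatorSuperalgebra V}
  {g : V ≃ₗ[ℂ] V}

theorem IsAutomorphism.commutator_residue_circ_mem_Og (hg : S.IsAutomorphism g) {p n r : ℕ}
    (hr : r < S.twistOrder g) {c u : V} (hc : c ∈ S.grade p) (hc0 : c ∈ S.eigen g 0)
    (hu : u ∈ S.grade n) (hur : u ∈ S.eigen g r) (v : V) :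
    S.residue ((p : ℂ) / 2) 1 c
      (S.residue (S.circExponent g ((n : ℂ) / 2) r) (circPole r) u v) ∈ S.Og g := by
  obtain ⟨I, hI⟩ := (S.eventually_commutator_residue hc hu v ((p : ℂ) / 2)
    (S.circExponent g ((n : ℂ) / 2) r) 1 (circPole r)).exists
  rw [sub_eq_iff_eq_add] at hI
  rw [hI]
  refine add_mem (sum_mem fun i _ => sum_mem fun y hy => Submodule.smul_mem _ _ ?_)
    (Submodule.smul_mem _ _ (residue_mem_Og hr (homogeneous_of_mem hu hur) _))
  have hm := hg.mode_mem_homogeneous (homogeneous_of_mem hc hc0) (homogeneous_of_mem hu hur) i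
  rw [zero_add] at hm
  -- Since c_i u has weight wt c + wt u - i - 1 and i = y.1 + y.2, exponent and pole both exceed
  -- those of (c_i u) ∘_g v by y.1 + 1.
  refine hg.residue_mem_Og_of_le hr hm v (le_refl (y.1 + 1)) ?_ (by push_cast; ring)
  rw [← HasAntidiagonal.mem_antidiagonal.1 hy]
  unfold circExponent
  push_cast; ring

theorem IsAutomorphism.star_mem_Og_of_right_mem (hg : S.IsAutomorphism g)
    (hT : 0 < S.twistOrder g) (c : V) {x : V} (hx : x ∈ S.Og g) : S.star g c x ∈ S.Og g := by
  have h : (S.Og g).comap ((S.star g).flip x) = ⊤ := by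
    refine hg.eq_top_of_homogeneous hT _ fun p s hs c hc hcs => ?_
    rw [Submodule.mem_comap, LinearMap.flip_apply]
    rcases Nat.eq_zero_or_pos s with rfl | hs0
    · rw [S.star_of_mem_zero g hT hc hcs]
      have : S.Og g ≤ (S.Og g).comap (S.residue ((p : ℂ) / 2) 1 c) := by
        refine Submodule.span_le.2 ?_
        rintro _ ⟨n, r, u, v, hr, hu, hur, rfl⟩
        exact hg.commutator_residue_circ_mem_Og hr hc hcs hu hur v
      exact this hx
    · rw [S.star_of_mem_pos g hs0 hs hcs]
      exact zero_mem _
  exact (Submodule.eq_top_iff'.1 h c :)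

theorem IsAutomorphism.star_residue_circ_mem_Og (hg : S.IsAutomorphism g)
    (hT : 0 < S.twistOrder g) {p q r s : ℕ} (hr : r < S.twistOrder g) (hs : s < S.twistOrder g)
    {u v : V} (hu : u ∈ S.grade p) (hur : u ∈ S.eigen g r)
    (hv : v ∈ S.grade q) (hvs : v ∈ S.eigen g s) (c : V) :
    S.star g (S.residue (S.circExponent g ((p : ℂ) / 2) r) (circPole r) u v) c ∈ S.Og g := by
  have hu' := homogeneous_of_mem hu hur
  have hv' := homogeneous_of_mem hv hvs
  by_cases hrs : S.twistOrder g ∣ r + s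
  · have hT' : (S.twistOrder g : ℂ) ≠ 0 := by exact_mod_cast hT.ne'
    have hcases : r = 0 ∧ s = 0 ∨ 0 < r ∧ 0 < s ∧ r + s = S.twistOrder g := by
      obtain ⟨t, ht⟩ := hrs
      rcases Nat.lt_or_ge t 2 with h2 | h2
      · interval_cases t <;> omega
      · have := Nat.mul_le_mul_left (S.twistOrder g) h2
        omega
    -- Taking β one above the exponent of v ∘_g makes α + β right in both cases. The extra 1 is
    -- allowed because the terms with v outermost have at least one extra pole.
    have hαβ : S.circExponent g ((p : ℂ) / 2) r + (S.circExponent g ((q : ℂ) / 2) s + (1 : ℕ))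
        = (p : ℂ) / 2 + (q : ℂ) / 2 + circPole r - 1 := by
      rcases hcases with ⟨rfl, rfl⟩ | ⟨h1, h2, h3⟩
      · rw [circExponent_zero, circExponent_zero, circPole_zero]
        push_cast; ring
      · have h4 : (r : ℂ) / S.twistOrder g + (s : ℂ) / S.twistOrder g = 1 := by
          rw [← add_div, div_eq_one_iff_eq hT']
          exact_mod_cast h3
        rw [circExponent, circExponent, circPole_of_pos h1, if_neg h1.ne', if_neg h2.ne']
        push_cast
        linear_combination h4
    have hpole : circPole r = circPole s := by
      rcases hcases with ⟨rfl, rfl⟩ | ⟨h1, h2, h3⟩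
      · rfl
      · rw [circPole_of_pos h1, circPole_of_pos h2]
    obtain ⟨I, hI⟩ := (hg.eventually_star_residue hT hu hv hur hvs hrs hαβ c).exists
    rw [hI]
    refine sub_mem (sum_mem fun i _ => Submodule.smul_mem _ _ ?_)
      (Submodule.smul_mem _ _ (sum_mem fun i _ => Submodule.smul_mem _ _ ?_))
    · exact hg.residue_mem_Og_of_le hr hu' _ (Nat.zero_le i) (by simp) rfl
    · exact hg.residue_mem_Og_of_le hs hv' _ (Nat.le_add_right 1 i) rfl
        (by rw [hpole]; push_cast; ring)
  · rw [star_eq_zero hT hrs (hg.residue_mem_eigen hu' hv' _ _)]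
    exact zero_mem _

theorem IsAutomorphism.star_mem_Og_of_left_mem (hg : S.IsAutomorphism g)
    (hT : 0 < S.twistOrder g) (c : V) {x : V} (hx : x ∈ S.Og g) : S.star g x c ∈ S.Og g := by
  have : S.Og g ≤ (S.Og g).comap ((S.star g).flip c) := by
    refine Submodule.span_le.2 ?_
    rintro _ ⟨p, r, u, v, hr, hu, hur, rfl⟩
    have h : (S.Og g).comap ((S.star g).flip c ∘ₗ
        S.residue (S.circExponent g ((p : ℂ) / 2) r) (circPole r) u) = ⊤ :=
      hg.eq_top_of_homogeneous hT _ fun q s hs v hv hvs =>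
        hg.star_residue_circ_mem_Og hT hr hs hu hur hv hvs c
    exact (Submodule.eq_top_iff'.1 h v :)
  exact (this hx :)

/-! ### Associativity -/

theorem IsAutomorphism.star_assoc_of_homogeneous (hg : S.IsAutomorphism g)
    (hT : 0 < S.twistOrder g) {p q : ℕ} {a b : V} (ha : a ∈ S.grade p) (ha0 : a ∈ S.eigen g 0)
    (hb : b ∈ S.grade q) (hb0 : b ∈ S.eigen g 0) (c : V) :
    S.star g (S.star g a b) c - S.star g a (S.star g b c) ∈ S.Og g := by
  have ha' := homogeneous_of_mem ha ha0
  have hb' := homogeneous_of_mem hb hb0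
  have hαβ : (p : ℂ) / 2 + (q : ℂ) / 2 = (p : ℂ) / 2 + (q : ℂ) / 2 + (1 : ℤ) - 1 := by
    push_cast; ring
  obtain ⟨I, hI, h1⟩ := ((hg.eventually_star_residue hT ha hb ha0 hb0 (dvd_zero _) hαβ c).and
    (eventually_ge_atTop 1)).exists
  obtain ⟨I, rfl⟩ := Nat.exists_eq_add_of_le' h1
  -- The term split off, i = 0, is a *_g (b *_g c); all the others have pole order at least 2 in the
  -- outer variable.
  rw [sum_range_succ'] at hI
  simp only [pow_zero, Ring.choose_zero_right, one_mul, one_smul, Nat.cast_zero, add_zero,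
    sub_zero] at hI
  rw [S.star_of_mem_zero g hT ha ha0, S.star_of_mem_zero g hT ha ha0,
    S.star_of_mem_zero g hT hb hb0, hI, add_sub_right_comm, add_sub_cancel_right]
  refine sub_mem (sum_mem fun i _ => Submodule.smul_mem _ _ ?_)
    (Submodule.smul_mem _ _ (sum_mem fun i _ => Submodule.smul_mem _ _ ?_))
  · exact hg.residue_mem_Og_of_le hT ha' _ (Nat.zero_le i) (by simp [circExponent_zero])
      (by rw [circPole_zero]; push_cast; ring)
  · exact hg.residue_mem_Og_of_le hT hb' _ (Nat.zero_le i) (by simp [circExponent_zero])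
      (by rw [circPole_zero]; push_cast; ring)

theorem IsAutomorphism.star_assoc_sub_mem_Og (hg : S.IsAutomorphism g)
    (hT : 0 < S.twistOrder g) (a b c : V) :
    S.star g (S.star g a b) c - S.star g a (S.star g b c) ∈ S.Og g := by
  have h : (S.Og g).comap ((S.star g).flip c ∘ₗ (S.star g).flip b
      - (S.star g).flip (S.star g b c)) = ⊤ := by
    refine hg.eq_top_of_homogeneous hT _ fun p r hr a ha har => ?_
    change S.star g (S.star g a b) c - S.star g a (S.star g b c) ∈ S.Og g
    rcases Nat.eq_zero_or_pos r with rfl | hr0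
    · have h : (S.Og g).comap ((S.star g).flip c ∘ₗ S.star g a
          - S.star g a ∘ₗ (S.star g).flip c) = ⊤ := by
        refine hg.eq_top_of_homogeneous hT _ fun q s hs b hb hbs => ?_
        change S.star g (S.star g a b) c - S.star g a (S.star g b c) ∈ S.Og g
        rcases Nat.eq_zero_or_pos s with rfl | hs0
        · exact hg.star_assoc_of_homogeneous hT ha har hb hbs c
        · have hb' := mem_Og_of_mem_eigen hs0 hs (homogeneous_of_mem hb hbs)
          exact sub_mem (hg.star_mem_Og_of_left_mem hT _ (hg.star_mem_Og_of_right_mem hT _ hb'))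
            (hg.star_mem_Og_of_right_mem hT _ (hg.star_mem_Og_of_left_mem hT _ hb'))
      exact (Submodule.eq_top_iff'.1 h b :)
    · rw [S.star_of_mem_pos g hr0 hr har, S.star_of_mem_pos g hr0 hr har]
      simp
  exact (Submodule.eq_top_iff'.1 h a :)

/-! ### The unit and the centrality of ω -/

theorem IsAutomorphism.vacuum_star (hg : S.IsAutomorphism g) (hT : 0 < S.twistOrder g) (v : V) :
    S.star g S.vacuum v = v := by
  have hv (n : ℤ) : S.mode S.vacuum n v = if n = -1 then v else 0 := S.vacuum_mode n v
  rw [S.star_of_mem_zero g hT S.vacuum_mem hg.vacuum_mem_eigen,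
    S.residue_eq_sum_range _ _ _ _ 1 fun n hn => by
      rw [hv, if_neg (by push_cast at hn; omega)], sum_range_one, hv, Ring.choose_zero_right]
  simp

theorem IsAutomorphism.star_vacuum_sub_mem_Og (hg : S.IsAutomorphism g)
    (hT : 0 < S.twistOrder g) (v : V) : S.star g v S.vacuum - v ∈ S.Og g := by
  have h : (S.Og g).comap ((S.star g).flip S.vacuum - LinearMap.id) = ⊤ := by
    refine hg.eq_top_of_homogeneous hT _ fun p r hr v hv hvr => ?_
    change S.star g v S.vacuum - v ∈ S.Og g
    rcases Nat.eq_zero_or_pos r with rfl | hr0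
    · rw [S.star_of_mem_zero g hT hv hvr, residue_one_vacuum, sub_self]
      exact zero_mem _
    · have hv' := mem_Og_of_mem_eigen hr0 hr (homogeneous_of_mem hv hvr)
      exact sub_mem (hg.star_mem_Og_of_left_mem hT _ hv') hv'
  exact (Submodule.eq_top_iff'.1 h v :)

/-- Lowering exponent and pole together by one changes the residue only by an element of O_g(V); at
k = 0 the residue is x itself. -/
theorem IsAutomorphism.residue_vacuum_sub_mem_Og (hg : S.IsAutomorphism g)
    (hT : 0 < S.twistOrder g) {w : ℂ} {x : V} (hx : x ∈ S.homogeneous g w 0) (k : ℕ) :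
    S.residue (w + k) (1 + k) x S.vacuum - x ∈ S.Og g := by
  induction k with
  | zero => simp [residue_one_vacuum]
  | succ k ih =>
    have h := S.residue_add_one (w + k) (1 + k) x S.vacuum
    rw [show w + ((k + 1 : ℕ) : ℂ) = w + k + 1 by push_cast; ring,
      show 1 + ((k + 1 : ℕ) : ℤ) = 1 + k + 1 by push_cast; ring, h, add_sub_assoc]
    refine add_mem (hg.residue_mem_Og_of_le hT hx _ (le_refl k) ?_ ?_) ih
    · rw [circExponent_zero]
    · rw [circPole_zero]; ring

/-- The commutator of `ω` with `b` in `A_g(V)` is the class of `L(-1) b + L(0) b`. -/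
theorem IsAutomorphism.conformal_star_sub_mem_Og (hg : S.IsAutomorphism g)
    (hT : 0 < S.twistOrder g) (v : V) :
    S.star g S.conformal v - S.star g v S.conformal ∈ S.Og g := by
  have h : (S.Og g).comap (S.star g S.conformal - (S.star g).flip S.conformal) = ⊤ := by
    refine hg.eq_top_of_homogeneous hT _ fun q r hr b hb hbr => ?_
    change S.star g S.conformal b - S.star g b S.conformal ∈ S.Og g
    rcases Nat.eq_zero_or_pos r with rfl | hr0
    swap
    · have hb' := mem_Og_of_mem_eigen hr0 hr (homogeneous_of_mem hb hbr)
      exact sub_mem (hg.star_mem_Og_of_right_mem hT _ hb') (hg.star_mem_Og_of_left_mem hT _ hb')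
    have hb' := homogeneous_of_mem hb hbr
    have hω := hg.conformal_mem_homogeneous
    obtain ⟨I, hI, h2⟩ := ((S.eventually_commutator_residue S.conformal_mem hb S.vacuum 2
      ((q : ℂ) / 2) 1 1).and (eventually_ge_atTop 2)).exists
    have he : Even (4 * q) := ⟨2 * q, by ring⟩
    rw [residue_one_vacuum, residue_one_vacuum, he.neg_one_pow, one_smul,
      ← star_eq_residue hT hω, ← star_eq_residue hT hb'] at hI
    rw [hI]
    -- Every residue with index i is congruent to ω_i b, so only the total coefficient matters: that
    -- of z^i in (1 + z)^(-1) (1 + z)^2 = 1 + z.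
    have hcoef (i : ℕ) : ∑ y ∈ antidiagonal i,
        (Ring.choose (-(1 : ℤ) : ℂ) y.1 * Ring.choose (2 : ℂ) y.2) = (Nat.choose 1 i : ℂ) := by
      rw [← Ring.add_choose_eq _ (Commute.all _ _), ← Ring.choose_natCast]
      congr 1; push_cast; norm_num
    have hsub : ∑ i ∈ range I, ∑ y ∈ antidiagonal i,
          (Ring.choose (-(1 : ℤ) : ℂ) y.1 * Ring.choose (2 : ℂ) y.2) •
          S.residue (2 + (q : ℂ) / 2 - y.2) (1 + 1 + y.1) (S.mode S.conformal i b) S.vacuum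
        - ∑ i ∈ range I, (Nat.choose 1 i : ℂ) • S.mode S.conformal i b ∈ S.Og g := by
      rw [← sum_sub_distrib]
      refine sum_mem fun i _ => ?_
      rw [← hcoef, sum_smul, ← sum_sub_distrib]
      refine sum_mem fun y hy => ?_
      rw [← smul_sub]
      have := hg.residue_vacuum_sub_mem_Og hT (hg.mode_mem_homogeneous hω hb' i) (y.1 + 1)
      refine Submodule.smul_mem _ _ ?_
      convert this using 5
      · rw [← HasAntidiagonal.mem_antidiagonal.1 hy]
        push_cast; ring
      · push_cast; ring
    have hsum : ∑ i ∈ range I, (Nat.choose 1 i : ℂ) • S.mode S.conformal i b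
        = S.mode S.conformal 0 b + ((q : ℂ) / 2) • b := by
      obtain ⟨I, rfl⟩ := Nat.exists_eq_add_of_le' h2
      rw [sum_range_succ', sum_range_succ', sum_eq_zero, zero_add, add_comm]
      · simp [mem_weightSpace.1 hb'.1]
      · intro i _
        rw [Nat.choose_eq_zero_of_lt (by omega), Nat.cast_zero, zero_smul]
    -- L(-1)b + L(0)b is b ∘_g 𝟏.
    rw [hsum, ← residue_two_vacuum] at hsub
    have hmem := residue_mem_Og hT hb' S.vacuum
    rw [circExponent_zero, circPole_zero] at hmem
    simpa using add_mem hsub hmem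
  exact (Submodule.eq_top_iff'.1 h v :)

end VertexOperatorSuperalgebra

end

/-! ### The algebra A_g(V) -/

theorem theorem3p3 {V : Type*} [AddCommGroup V] [Module ℂ V]
    (S : VertexOperatorSuperalgebra V) (g : V ≃ₗ[ℂ] V)
    (hg : S.IsAutomorphism g) (hfin : IsOfFinOrder g) :
    ∃ μ : S.Ag g →ₗ[ℂ] S.Ag g →ₗ[ℂ] S.Ag g,
      (∀ u v : V, μ ((S.Og g).mkQ u) ((S.Og g).mkQ v) = (S.Og g).mkQ (S.star g u v)) ∧
      (∀ a b c : S.Ag g, μ (μ a b) c = μ a (μ b c)) ∧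
      (∀ a : S.Ag g, μ ((S.Og g).mkQ S.vacuum) a = a ∧ μ a ((S.Og g).mkQ S.vacuum) = a) ∧
      (∀ a : S.Ag g, μ ((S.Og g).mkQ S.conformal) a = μ a ((S.Og g).mkQ S.conformal)) := by
  have hT := hg.twistOrder_pos hfin
  let L : V →ₗ[ℂ] V →ₗ[ℂ] S.Ag g := (S.star g).compr₂ (S.Og g).mkQ
  have hL (u v : V) : L u v = (S.Og g).mkQ (S.star g u v) := rfl
  let L₁ : S.Ag g →ₗ[ℂ] V →ₗ[ℂ] S.Ag g := (S.Og g).liftQ L fun x hx => by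
    rw [LinearMap.mem_ker]
    ext v
    exact (Submodule.Quotient.mk_eq_zero _).2 (hg.star_mem_Og_of_left_mem hT v hx)
  let μ : S.Ag g →ₗ[ℂ] S.Ag g →ₗ[ℂ] S.Ag g :=
      LinearMap.flip <| (S.Og g).liftQ L₁.flip fun x hx => by
    rw [LinearMap.mem_ker]
    ext v
    exact (Submodule.Quotient.mk_eq_zero _).2 (hg.star_mem_Og_of_right_mem hT v hx)
  have hμ (u v : V) : μ ((S.Og g).mkQ u) ((S.Og g).mkQ v) = (S.Og g).mkQ (S.star g u v) := rfl
  have hmk (x y : V) (h : x - y ∈ S.Og g) : (S.Og g).mkQ x = (S.Og g).mkQ y :=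
    (Submodule.Quotient.eq _).2 h
  refine ⟨μ, hμ, fun a b c => ?_, fun a => ⟨?_, ?_⟩, fun a => ?_⟩
  · obtain ⟨a, rfl⟩ := (S.Og g).mkQ_surjective a
    obtain ⟨b, rfl⟩ := (S.Og g).mkQ_surjective b
    obtain ⟨c, rfl⟩ := (S.Og g).mkQ_surjective c
    simp only [hμ]
    exact hmk _ _ (hg.star_assoc_sub_mem_Og hT a b c)
  · obtain ⟨a, rfl⟩ := (S.Og g).mkQ_surjective a
    rw [hμ, hg.vacuum_star hT]
  · obtain ⟨a, rfl⟩ := (S.Og g).mkQ_surjective a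
    rw [hμ]
    exact hmk _ _ (hg.star_vacuum_sub_mem_Og hT a)
  · obtain ⟨a, rfl⟩ := (S.Og g).mkQ_surjective a
    rw [hμ, hμ]
    exact hmk _ _ (hg.conformal_star_sub_mem_Og hT a)
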